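/- Let $I=(0,\infty)$, $dm=2x^2\,dx$ on $I$, and let $\mathcal E$ be the Bessel Dirichlet form (case $n=3$) in $L^2(I,m)$: $$\mathcal D=\Big\{u\in L^2(I,m):\ u\in AC_{loc}(I),\ \int_0^\infty u'(x)^2x^2\,dx<\infty\Big\},\qquad \mathcal E(u,v)=\int_0^\infty u'(x)v'(x)\,x^2\,dx .$$ Write $\mathcal E[u]=\mathcal E(u,u)$ and, for $\lambda>0$, $\mathcal E_\lambda(u,v)=\mathcal E(u,v)+\lambda\int_I uv\,dm$. Let $\mu=\sum_{k\ge1}a_k\delta_k$ on $\mathbb N=\{1,2,\dots\}$ with $a_k>0$ for all $k$. Let $J$ be the restriction operator $Ju=u|_{\mathbb N}$ from $D(J)=\{u\in\mathcal D:\sum_k a_ku(k)^2<\infty\}$ to $\ell^2(\mathbb N,\mu)$, so that $\ker J=\{u\in\mathcal D:u(k)=0\ \forall k\in\mathbb N\}$. For $\lambda>0$ let $P_\lambda$ be the $\mathcal E_\lambda$-orthogonal projection of $\mathcal D$ onto the $\mathcal E_\lambda$-orthogonal complement of $\ker J$, and put $$\check{\mathcal E}_\lambda[Ju]=\mathcal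 E_\lambda[P_\lambda u]\quad(u\in D(J)),\qquad \check{\mathcal E}_\lambda=\infty \text{ off the range of } J .$$ The trace form $\check{\mathcal E}$ of $\mathcal E$ on $\mathbb N$ with respect to $\mu$ is the Mosco limit of $\check{\mathcal E}_\lambda$ in $\ell^2(\mathbb N,\mu)$ as $\lambda\downarrow0$, that is, $$\check{\mathcal E}[u]=\inf\big\{\liminf_{n}\check{\mathcal E}_{\lambda_n}[u_n]:\ \lambda_n\downarrow0,\ u_n\rightharpoonup u \text{ weakly in } \ell^2(\mathbb N,\mu)\big\}\in[0,\infty],$$ where $\lambda_n\downarrow 0$ means $\lambda_n\to0$ with $\lambda_n>0$ for all large $n$; its domain is $\check{\mathcal D}=\{u\in\ell^2(\mathbb N,\mu):\check{\mathcal E}[u]<\infty\}$. **Proposition.** There is a finite constant $c>0$, not depending on the weights $(a_k)$, such that $$|u_k|\le\frac{c}{k^{1/2}}\,(\check{\mathcal E}[u])^{1/2}\qquad\text{for all } u=(u_k)\in\check{\mathcal D}\text{ and all }k\in\mathbb N .$$ -/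

import Mathlib

open MeasureTheory Filter Topology Set
open scoped ENNReal NNReal

namespace BesselTrace

noncomputable section

/-- The measure `dm = 2 x² dx` on `I = (0, ∞)` (Bessel case `n = 3`). -/
def besselMeasure : Measure ℝ :=
  (volume.restrict (Ioi (0 : ℝ))).withDensity (fun x => ENNReal.ofReal (2 * x ^ 2))

/-- `u ∈ AC(I)`, `I = (0, ∞)`: absolute continuity on every compact subinterval of `I`.
Functions on `I` are represented by functions on `ℝ` whose values off `I` play no role. -/
def IsACOnHalfLine (u : ℝ → ℝ) : Prop :=
  ∀ x y : ℝ, 0 < x → x < y → AbsolutelyContinuousOnInterval u x y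

/-- The domain `𝓓` of the Bessel Dirichlet form in `L²(I, m)`; for `u ∈ AC(I)` the function
`deriv u` is the almost everywhere defined derivative of `u`. -/
def besselDomain : Set (ℝ → ℝ) :=
  {u | IsACOnHalfLine u ∧
    IntegrableOn (fun x => (deriv u x) ^ 2 * x ^ 2) (Ioi (0 : ℝ)) ∧
    MemLp u 2 besselMeasure}

/-- The Bessel Dirichlet form, `𝓔(u, v) = ∫₀^∞ u'(x) v'(x) x² dx`. -/
def besselForm (u v : ℝ → ℝ) : ℝ :=
  ∫ x in Ioi (0 : ℝ), deriv u x * deriv v x * x ^ 2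

/-- `𝓔_l(u, v) = 𝓔(u, v) + l ∫ u v dm`. -/
def besselFormShift (l : ℝ) (u v : ℝ → ℝ) : ℝ :=
  besselForm u v + l * ∫ x, u x * v x ∂besselMeasure

/-- All subsets of `{1, 2, 3, …}` are measurable. -/
instance instMeasurableSpacePNat : MeasurableSpace ℕ+ := ⊤

instance instDiscreteMeasurableSpacePNat : DiscreteMeasurableSpace ℕ+ := ⟨fun _ => trivial⟩

/-- The discrete measure `μ = ∑_{k ≥ 1} a_k δ_k`, on `{1, 2, 3, …}`. -/
def discreteMeasure (a : ℕ+ → ℝ) : Measure ℕ+ :=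
  Measure.sum fun k => ENNReal.ofReal (a k) • Measure.dirac k

/-- The Hilbert space `ℓ²(μ) = L²({1, 2, …}, μ)`. If all `a k` are positive, then the only
`μ`-null set is empty, so that an element `f` has well-defined values `f k`. -/
abbrev EllTwo (a : ℕ+ → ℝ) : Type := Lp ℝ 2 (discreteMeasure a)

/-- The restriction of a function to `{1, 2, …}`. -/
def restrictPNat (u : ℝ → ℝ) : ℕ+ → ℝ := fun k => u (k : ℝ)

/-- `D(J)`: the elements of `𝓓` whose restriction to `{1, 2, …}` is square summable
for the weights `a`. -/
def domJ (a : ℕ+ → ℝ) : Set (ℝ → ℝ) :=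
  {u | u ∈ besselDomain ∧ MemLp (restrictPNat u) 2 (discreteMeasure a)}

/-- The restriction operator `J : D(J) → ℓ²(μ)`. -/
def restrictionJ (a : ℕ+ → ℝ) (u : domJ a) : EllTwo a := u.2.2.toLp _

/-- `ker J = {u ∈ 𝓓 : u(k) = 0 for all k ≥ 1}`. -/
def kerJ : Set (ℝ → ℝ) := {u | u ∈ besselDomain ∧ ∀ k : ℕ+, u (k : ℝ) = 0}

/-- `w = P_l u`: `w` is the `𝓔_l`-orthogonal projection of `u` onto the `𝓔_l`-orthogonal
complement of `ker J` in `𝓓`. -/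
def IsProjection (l : ℝ) (u w : ℝ → ℝ) : Prop :=
  w ∈ besselDomain ∧ (∀ v ∈ kerJ, besselFormShift l w v = 0) ∧ u - w ∈ kerJ

/-- The approximating form: its value at `J u`, `u ∈ D(J)`, is `𝓔_l[P_l u]`
(the value does not depend on the choice of `u`), and its value off the range of `J` is `∞`. -/
def approxTraceForm (a : ℕ+ → ℝ) (l : ℝ) (f : EllTwo a) : ℝ≥0∞ :=
  ⨅ (u : domJ a) (_ : restrictionJ a u = f) (w : ℝ → ℝ) (_ : IsProjection l u w),
    ENNReal.ofReal (besselFormShift l w w)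

section Mosco

variable {H : Type*} [NormedAddCommGroup H] [InnerProductSpace ℝ H]

/-- Weak convergence of a sequence in a real inner product space. -/
def WeaklyTendsto (u : ℕ → H) (u₀ : H) : Prop :=
  ∀ g : H, Tendsto (fun n => inner ℝ (u n) g) atTop (𝓝 (inner ℝ u₀ g))

/-- Mosco convergence `F l → G` as `l ↓ 0` of extended nonnegative functionals. -/
def IsMoscoLimit (F : ℝ → H → ℝ≥0∞) (G : H → ℝ≥0∞) : Prop :=
  ∀ l : ℕ → ℝ, Tendsto l atTop (𝓝[>] 0) →
    (∀ (u : ℕ → H) (u₀ : H), WeaklyTendsto u u₀ →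
      G u₀ ≤ liminf (fun n => F (l n) (u n)) atTop) ∧
    (∀ u₀ : H, ∃ u : ℕ → H, Tendsto u atTop (𝓝 u₀) ∧
      limsup (fun n => F (l n) (u n)) atTop ≤ G u₀)

/-- The Mosco limit of `F l` as `l ↓ 0`, written as a total functional: the infimum of
`liminf F (l n) (u n)` over all sequences `l n ↓ 0` and `u n → u₀` weakly. Whenever `F l` has a
Mosco limit, it is this functional, see `IsMoscoLimit.eq_moscoLim`. -/
def moscoLim (F : ℝ → H → ℝ≥0∞) (u₀ : H) : ℝ≥0∞ :=
  ⨅ (l : ℕ → ℝ) (_ : Tendsto l atTop (𝓝[>] 0)) (u : ℕ → H) (_ : WeaklyTendsto u u₀),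
    liminf (fun n => F (l n) (u n)) atTop

/-- A Mosco limit is unique, and it is `moscoLim F`. -/
theorem IsMoscoLimit.eq_moscoLim {F : ℝ → H → ℝ≥0∞} {G : H → ℝ≥0∞}
    (h : IsMoscoLimit F G) : G = moscoLim F := by
  funext u₀
  refine le_antisymm ?_ ?_
  · exact le_iInf₂ fun l hl => le_iInf₂ fun u hu => (h l hl).1 u u₀ hu
  · have hl : Tendsto (fun n : ℕ => 1 / ((n : ℝ) + 1)) atTop (𝓝[>] 0) :=
      tendsto_nhdsWithin_iff.2 ⟨tendsto_one_div_add_atTop_nhds_zero_nat,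
        Eventually.of_forall fun n => by
          have : (0 : ℝ) < 1 / ((n : ℝ) + 1) := by positivity
          exact this⟩
    obtain ⟨u, hu, hlim⟩ := (h _ hl).2 u₀
    have hw : WeaklyTendsto u u₀ := fun g => hu.inner tendsto_const_nhds
    calc moscoLim F u₀ ≤ liminf (fun n : ℕ => F (1 / ((n : ℝ) + 1)) (u n)) atTop :=
          iInf₂_le_of_le _ hl (iInf₂_le u hw)
      _ ≤ limsup (fun n : ℕ => F (1 / ((n : ℝ) + 1)) (u n)) atTop := liminf_le_limsup
      _ ≤ G u₀ := hlim

end Mosco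

/-- The trace form of the Bessel form with respect to `μ = ∑ a_k δ_k`: the Mosco limit of the
approximating forms as `l ↓ 0`. It is `∞` off the form domain. -/
def traceForm (a : ℕ+ → ℝ) : EllTwo a → ℝ≥0∞ := moscoLim (approxTraceForm a)

/-- The domain of the trace form. -/
def traceDomain (a : ℕ+ → ℝ) : Set (EllTwo a) := {u | traceForm a u < ∞}

end

end BesselTrace

namespace BesselTrace

/-! The constant `1` works. For `w` in the Bessel domain, write `w x` as minus the integral of `w'`
over `(x, ∞)`; Cauchy–Schwarz against `∫_x^∞ t⁻² dt = 1/x` gives `x w(x)² ≤ 𝓔(w, w)`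
(`mul_sq_le_besselForm`). The boundary term at infinity disappears because `w` is square integrable
for a measure that is infinite on half-lines.

This bound does not involve `l` or the weights. It passes to the approximating forms, since `P_l u`
and `u` agree on the integers and `𝓔 ≤ 𝓔_l`, and then to the Mosco limit, since evaluation at `k` is
weakly continuous on `ℓ²(μ)`. The trace form never has to be computed. -/

/-- The measure `2 x² dx` of a half-line is infinite. -/
theorem besselMeasure_Ioi_eq_top {x : ℝ} (hx : 0 < x) : besselMeasure (Ioi x) = ∞ := by
  have hsub : Ioi x ⊆ Ioi (0 : ℝ) := Ioi_subset_Ioi hx.le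
  rw [besselMeasure, withDensity_apply _ measurableSet_Ioi,
    Measure.restrict_restrict measurableSet_Ioi, inter_eq_left.2 hsub, eq_top_iff]
  calc (∞ : ℝ≥0∞) = ∫⁻ _ in Ioi x, ENNReal.ofReal (2 * x ^ 2) := by
        rw [setLIntegral_const, Real.volume_Ioi, ENNReal.mul_top]
        exact (ENNReal.ofReal_pos.2 (by positivity)).ne'
    _ ≤ ∫⁻ t in Ioi x, ENNReal.ofReal (2 * t ^ 2) := by
        refine setLIntegral_mono' measurableSet_Ioi fun t ht => ENNReal.ofReal_le_ofReal ?_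
        have : x ≤ t := (mem_Ioi.1 ht).le
        gcongr

/-- A function in `L²(2 x² dx)` takes arbitrarily small values on every half-line. -/
theorem exists_gt_abs_lt {w : ℝ → ℝ} (hw : MemLp w 2 besselMeasure) {x ε : ℝ} (hx : 0 < x)
    (hε : 0 < ε) : ∃ y, x < y ∧ |w y| < ε := by
  by_contra! h
  -- Chebyshev: a superlevel set of an `L²` function has finite measure, but this one would contain
  -- a half-line.
  have hlt : besselMeasure {y | Real.toNNReal ε ≤ ‖w y‖₊} < ∞ :=
    hw.meas_ge_lt_top (by norm_num) (by norm_num) (by simpa using hε)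
  refine (hlt.trans_le (le_top)).ne' ?_
  rw [eq_comm, eq_top_iff, ← besselMeasure_Ioi_eq_top hx]
  refine measure_mono fun y hy => ?_
  rw [mem_ofPred_eq, Real.toNNReal_le_iff_le_coe, coe_nnnorm, Real.norm_eq_abs]
  exact h y hy

theorem integral_inv_sq {x y : ℝ} (hx : 0 < x) (hxy : x < y) :
    ∫ t in x..y, (t ^ 2)⁻¹ = x⁻¹ - y⁻¹ := by
  have h0 : (0 : ℝ) ∉ uIcc x y := by
    rw [uIcc_of_le hxy.le]
    exact fun h => hx.not_ge h.1
  have h := integral_zpow (a := x) (b := y) (n := -2) (Or.inr ⟨by norm_num, h0⟩)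
  have h1 : ∀ t : ℝ, t ^ (-2 : ℤ) = (t ^ 2)⁻¹ := fun t => by
    rw [zpow_neg]; norm_cast
  simp only [h1] at h
  rw [h]
  norm_num
  ring

/-- The increment of `w` between `x` and `y`, estimated by the energy with a free parameter. -/
theorem abs_sub_le_besselForm {w : ℝ → ℝ} (hw : w ∈ besselDomain) {x y s : ℝ} (hx : 0 < x)
    (hxy : x < y) (hs : 0 < s) : |w y - w x| ≤ (s * besselForm w w + s⁻¹ * x⁻¹) / 2 := by
  obtain ⟨hac, hint, -⟩ := hw
  have hac := hac x y hx hxy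
  have hsub : Ioc x y ⊆ Ioi (0 : ℝ) := fun t ht => hx.trans ht.1
  have hI : IntervalIntegrable (fun t => (deriv w t) ^ 2 * t ^ 2) volume x y :=
    (intervalIntegrable_iff_integrableOn_Ioc_of_le hxy.le).2 (hint.mono_set hsub)
  have hJ : IntervalIntegrable (fun t : ℝ => (t ^ 2)⁻¹) volume x y := by
    refine ContinuousOn.intervalIntegrable fun t ht => ?_
    rw [uIcc_of_le hxy.le] at ht
    have : t ^ 2 ≠ 0 := pow_ne_zero _ (hx.trans_le ht.1).ne'
    exact ((continuousAt_id.pow 2).inv₀ this).continuousWithinAt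
  have hE : ∫ t in x..y, (deriv w t) ^ 2 * t ^ 2 ≤ besselForm w w := by
    rw [intervalIntegral.integral_of_le hxy.le]
    have : besselForm w w = ∫ t in Ioi (0 : ℝ), (deriv w t) ^ 2 * t ^ 2 := by
      simp only [besselForm, sq]
    rw [this]
    exact setIntegral_mono_set hint (Eventually.of_forall fun t => by positivity)
      hsub.eventuallyLE
  have hy : 0 < y⁻¹ := inv_pos.2 (hx.trans hxy)
  calc |w y - w x| = |∫ t in x..y, deriv w t| := by rw [hac.integral_deriv_eq_sub]
    _ ≤ ∫ t in x..y, |deriv w t| := intervalIntegral.abs_integral_le_integral_abs hxy.le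
    _ ≤ ∫ t in x..y, (s / 2 * ((deriv w t) ^ 2 * t ^ 2) + s⁻¹ / 2 * (t ^ 2)⁻¹) := by
        refine intervalIntegral.integral_mono_on hxy.le hac.intervalIntegrable_deriv.abs
          ((hI.const_mul _).add (hJ.const_mul _)) fun t ht => ?_
        have ht0 : 0 < t := hx.trans_le ht.1
        -- Young's inequality for the product of `|w'| t` and `1/t`, as a completed square; the
        -- weight `s` is optimized later.
        have hid : s / 2 * ((deriv w t) ^ 2 * t ^ 2) + s⁻¹ / 2 * (t ^ 2)⁻¹ - |deriv w t|
            = s / 2 * (|deriv w t| * t - (s * t)⁻¹) ^ 2 := by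
          rw [← sq_abs (deriv w t)]
          field_simp
          ring
        have : 0 ≤ s / 2 * (|deriv w t| * t - (s * t)⁻¹) ^ 2 := by positivity
        linarith
    _ = s / 2 * (∫ t in x..y, (deriv w t) ^ 2 * t ^ 2) + s⁻¹ / 2 * (x⁻¹ - y⁻¹) := by
        rw [intervalIntegral.integral_add (hI.const_mul _) (hJ.const_mul _),
          intervalIntegral.integral_const_mul, intervalIntegral.integral_const_mul,
          integral_inv_sq hx hxy]
    _ ≤ s / 2 * besselForm w w + s⁻¹ / 2 * x⁻¹ := by
        gcongr
        linarith
    _ = _ := by ring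

/-- The pointwise estimate `x w(x)² ≤ 𝓔(w, w)` on the domain of the Bessel form. -/
theorem mul_sq_le_besselForm {w : ℝ → ℝ} (hw : w ∈ besselDomain) {x : ℝ} (hx : 0 < x) :
    x * w x ^ 2 ≤ besselForm w w := by
  have key : ∀ s : ℝ, 0 < s → |w x| ≤ (s * besselForm w w + s⁻¹ * x⁻¹) / 2 := by
    intro s hs
    refine le_of_forall_pos_le_add fun ε hε => ?_
    obtain ⟨y, hxy, hy⟩ := exists_gt_abs_lt hw.2.2 hx hε
    have h1 := abs_sub_le_besselForm hw hx hxy hs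
    have h2 := abs_sub_abs_le_abs_sub (w x) (w y)
    rw [abs_sub_comm] at h2
    linarith
  rcases eq_or_ne (w x) 0 with h0 | h0
  · rw [h0, zero_pow two_ne_zero, mul_zero]
    exact setIntegral_nonneg measurableSet_Ioi fun t _ =>
      mul_nonneg (mul_self_nonneg (deriv w t)) (sq_nonneg t)
  · have hpos : 0 < |w x| := abs_pos.2 h0
    -- This `s` turns the second term into `|w x|`, which the left side absorbs; no square root of
    -- the energy is needed, and zero energy is no special case.
    have h := key (x * |w x|)⁻¹ (by positivity)
    have h1 : ((x * |w x|)⁻¹)⁻¹ * x⁻¹ = |w x| := by field_simp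
    have h2 : |w x| ≤ (x * |w x|)⁻¹ * besselForm w w := by linarith
    have h3 : |w x| * (x * |w x|) ≤ besselForm w w := by
      have := mul_le_mul_of_nonneg_left h2 (by positivity : 0 ≤ x * |w x|)
      rw [mul_inv_cancel_left₀ (by positivity)] at this
      linarith
    rw [← sq_abs]
    linarith

theorem besselForm_le_besselFormShift {l : ℝ} (hl : 0 ≤ l) (w : ℝ → ℝ) :
    besselForm w w ≤ besselFormShift l w w :=
  le_add_of_nonneg_right (mul_nonneg hl (integral_nonneg fun x => mul_self_nonneg (w x)))

theorem discreteMeasure_singleton (a : ℕ+ → ℝ) (k : ℕ+) :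
    discreteMeasure a {k} = ENNReal.ofReal (a k) := by
  rw [discreteMeasure, Measure.sum_apply _ (measurableSet_singleton k), tsum_eq_single k]
  · simp
  · intro j hj
    simp [hj]

/-- Each singleton has positive mass, so null sets are empty and `L²` classes have genuine point
values. -/
theorem eq_of_ae_eq_discreteMeasure {a : ℕ+ → ℝ} (ha : ∀ k, 0 < a k) {f g : ℕ+ → ℝ}
    (h : f =ᵐ[discreteMeasure a] g) (k : ℕ+) : f k = g k := by
  by_contra hk
  have h0 : discreteMeasure a {k} = 0 :=
    measure_mono_null (singleton_subset_iff.2 hk) (ae_iff.1 h)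
  rw [discreteMeasure_singleton, ENNReal.ofReal_eq_zero] at h0
  exact h0.not_gt (ha k)

/-- Evaluation at a point is weakly continuous on `ℓ²(μ)`. -/
theorem WeaklyTendsto.apply {a : ℕ+ → ℝ} (ha : ∀ k, 0 < a k) {u : ℕ → EllTwo a} {u₀ : EllTwo a}
    (h : WeaklyTendsto u u₀) (k : ℕ+) : Tendsto (fun n => u n k) atTop (𝓝 (u₀ k)) := by
  have hfin : discreteMeasure a {k} ≠ ∞ := by
    rw [discreteMeasure_singleton]; exact ENNReal.ofReal_ne_top
  -- Evaluation at `k` is, up to the factor `a k`, the inner product with the indicator of `{k}`.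
  have hinner : ∀ f : EllTwo a,
      inner ℝ f (indicatorConstLp 2 (measurableSet_singleton k) hfin (1 : ℝ)) = a k * f k := by
    intro f
    rw [real_inner_comm, L2.inner_indicatorConstLp_one, integral_singleton, Measure.real,
      discreteMeasure_singleton, ENNReal.toReal_ofReal (ha k).le, smul_eq_mul]
  have := (h (indicatorConstLp 2 (measurableSet_singleton k) hfin (1 : ℝ))).const_mul (a k)⁻¹
  simpa only [hinner, inv_mul_cancel_left₀ (ha k).ne'] using this

/-- Every competitor `w` lies in the Bessel domain and differs from `u` by an element of `ker J`, so
`w k = f k` and the pointwise estimate applies to `w`. -/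
theorem ofReal_mul_sq_le_approxTraceForm {a : ℕ+ → ℝ} (ha : ∀ k, 0 < a k) {l : ℝ} (hl : 0 ≤ l)
    (f : EllTwo a) (k : ℕ+) :
    ENNReal.ofReal (k * f k ^ 2) ≤ approxTraceForm a l f := by
  refine le_iInf₂ fun u hu => le_iInf₂ fun w hw => ENNReal.ofReal_le_ofReal ?_
  have h1 : f k = w k := by
    have h2 : f k = u.1 k := by
      rw [← hu]
      exact eq_of_ae_eq_discreteMeasure ha u.2.2.coeFn_toLp k
    have h3 : u.1 k - w k = 0 := hw.2.2.2 k
    linarith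
  rw [h1]
  exact (mul_sq_le_besselForm hw.1 (by exact_mod_cast k.pos)).trans
    (besselForm_le_besselFormShift hl w)

/-- The left side converges along weakly convergent sequences, so the uniform bound survives the
liminf. -/
theorem ofReal_mul_sq_le_traceForm {a : ℕ+ → ℝ} (ha : ∀ k, 0 < a k) (u : EllTwo a) (k : ℕ+) :
    ENNReal.ofReal (k * u k ^ 2) ≤ traceForm a u := by
  refine le_iInf₂ fun l hl => le_iInf₂ fun v hv => ?_
  have ht : Tendsto (fun n => ENNReal.ofReal (k * v n k ^ 2)) atTop
      (𝓝 (ENNReal.ofReal (k * u k ^ 2))) :=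
    ENNReal.tendsto_ofReal (((hv.apply ha k).pow 2).const_mul _)
  rw [← ht.liminf_eq]
  refine liminf_le_liminf ?_
  filter_upwards [(tendsto_nhdsWithin_iff.1 hl).2] with n hn
  exact ofReal_mul_sq_le_approxTraceForm ha (mem_Ioi.1 hn).le (v n) k

end BesselTrace

theorem mainTheorem10 :
    ∃ c : ℝ, 0 < c ∧
      ∀ a : ℕ+ → ℝ, (∀ k, 0 < a k) →
        ∀ u ∈ BesselTrace.traceDomain a, ∀ k : ℕ+,
          |u k| ≤ c / Real.sqrt (k : ℝ) * Real.sqrt (BesselTrace.traceForm a u).toReal := by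
  refine ⟨1, one_pos, fun a ha u hu k => ?_⟩
  have hk : (0 : ℝ) < k := by exact_mod_cast k.pos
  have h : (k : ℝ) * u k ^ 2 ≤ (BesselTrace.traceForm a u).toReal :=
    (ENNReal.ofReal_le_iff_le_toReal (ne_of_lt hu)).1
      (BesselTrace.ofReal_mul_sq_le_traceForm ha u k)
  rw [one_div_mul_eq_div, le_div_iff₀ (Real.sqrt_pos.2 hk), ← Real.sqrt_sq_eq_abs,
    ← Real.sqrt_mul (sq_nonneg _)]
  exact Real.sqrt_le_sqrt (by linarith)
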